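/- All matroids have finite ground sets, and a \emph{class} of matroids is a collection of matroids that is closed under isomorphism. For a matroid $M$ with rank function $r$, a set $Y\subseteq E(M)$ and an element $e\notin E(M)$, the \emph{principal extension} $M+_Y e$ is the matroid on $E(M)\cup\{e\}$ whose rank function satisfies $r_{M+_Ye}(X)=r(X)$ and $r_{M+_Ye}(X\cup\{e\})=\min\{r(X)+1,\;r(X\cup Y)\}$ for all $X\subseteq E(M)$. The \emph{truncation} of $M$ is $(M+_{E(M)}e)/e$. For a finite directed graph $\Gamma$ with vertex set $V(\Gamma)\supseteq E(M)$, the matroid \emph{induced} from $M$ by $\Gamma$ is the matroid $\Gamma(M)$ on $V(\Gamma)$ in which a set $X\subseteq V(\Gamma)$ is independent if and only if $X$ can be linked to an independent set $I$ of $M$, that is, there are $|X|=|I|$ pairwise vertex-disjoint directed paths (single vertices allowed) whose initial vertices are the elements of $X$ and whose terminal vertices are the elements of $I$. A class of matroids is \emph{complete} if it is closed under minors, duals, direct sums, truncations, and induction by directed graphs. \textbf{Theorem.} A class of matroids is complete if and only if it is closed under minors, duals, direct sums, and principal extensions. -/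

import Mathlib

universe u v

/-- The principal extension `M +_Y e`, obtained by adding the new element `e` freely to `Y`.
A set `I` is independent when `I \ {e}` is independent in `M` and, if `e ∈ I`, the set `Y` is not
spanned by `I \ {e}`.  The usual description by ranks is `eRk_principalExtension` and
`eRk_principalExtension_insert`. -/
def Matroid.principalExtension {α : Type u} (M : Matroid α) [M.Finite] (Y : Set α) (e : α)
    (hY : Y ⊆ M.E) (he : e ∉ M.E) : Matroid α :=
  (IndepMatroid.ofFinite (E := insert e M.E) (M.ground_finite.insert e)
    (fun I => M.Indep (I \ {e}) ∧ (e ∈ I → ¬ Y ⊆ M.closure (I \ {e})))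
    (by simp)
    (by
      rintro I J ⟨hJ, hJ'⟩ hIJ
      refine ⟨hJ.subset (Set.sdiff_subset_sdiff_left hIJ), fun heI h => hJ' (hIJ heI) ?_⟩
      exact h.trans (M.closure_subset_closure (Set.sdiff_subset_sdiff_left hIJ)))
    (by
      have key : ∀ {A B : Set α}, M.Indep A → M.Indep B → B ⊆ M.closure A →
          A.ncard ≤ B.ncard → M.closure A ⊆ M.closure B := by
        intro A B hA hB hBA hc
        have hfA := M.ground_finite.subset hA.subset_ground
        have hfB := M.ground_finite.subset hB.subset_ground
        have hbas : M.IsBasis B (M.closure A) := by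
          obtain ⟨K, hK, hBK⟩ := hB.subset_isBasis_of_subset hBA
          have h1 : K.encard = A.encard := hK.encard_eq_encard hA.isBasis_closure
          have hfK := M.ground_finite.subset hK.indep.subset_ground
          have h2 : K.ncard = A.ncard := by simp [Set.ncard, h1]
          rwa [Set.eq_of_subset_of_ncard_le hBK (by omega) hfK]
        rw [hbas.closure_eq_closure, M.closure_closure]
      have bound : ∀ {A B : Set α}, M.Indep A → M.Indep B → B ⊆ M.closure A →
          B.ncard ≤ A.ncard := by
        intro A B hA hB hBA
        have hfA := M.ground_finite.subset hA.subset_ground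
        obtain ⟨K, hK, hBK⟩ := hB.subset_isBasis_of_subset hBA
        have h1 : K.encard = A.encard := hK.encard_eq_encard hA.isBasis_closure
        have hfK := M.ground_finite.subset hK.indep.subset_ground
        have h2 : K.ncard = A.ncard := by simp [Set.ncard, h1]
        exact h2 ▸ Set.ncard_le_ncard hBK hfK
      rintro I J ⟨hI, hI'⟩ ⟨hJ, hJ'⟩ hlt
      have hfI := M.ground_finite.subset hI.subset_ground
      have hfJ := M.ground_finite.subset hJ.subset_ground
      -- adding an old element `x` of `J` outside the span of `I \ {e}`
      have add_old : ∀ x, x ∈ J \ {e} → x ∉ M.closure (I \ {e}) →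
          (e ∈ I → ¬ Y ⊆ M.closure (insert x (I \ {e}))) →
          ∃ x ∈ J, x ∉ I ∧ M.Indep (insert x I \ {e}) ∧
            (e ∈ insert x I → ¬ Y ⊆ M.closure (insert x I \ {e})) := by
        intro x hx hxI hY'
        have hxe : x ≠ e := hx.2
        have heq : insert x I \ {e} = insert x (I \ {e}) := by
          ext z; simp only [Set.mem_sdiff, Set.mem_insert_iff, Set.mem_singleton_iff]
          constructor
          · rintro ⟨h1 | h1, h2⟩ <;> tauto
          · rintro (h1 | h1)
            · exact ⟨Or.inl h1, h1 ▸ hxe⟩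
            · tauto
        have hxI' : x ∉ I := fun h =>
          hxI (M.subset_closure _ hI.subset_ground ⟨h, hxe⟩)
        refine ⟨x, hx.1, hxI', ?_, ?_⟩
        · rw [heq, hI.insert_indep_iff]
          exact Or.inl ⟨hJ.subset_ground hx, hxI⟩
        · rw [heq]
          rintro (h | h)
          · exact absurd h.symm hxe
          · exact hY' h
      by_cases heI : e ∈ I
      · have hcI : (I \ {e}).ncard + 1 = I.ncard :=
          Set.ncard_sdiff_singleton_add_one heI ((hfI.insert e).subset (by simp))
        by_contra hcon
        have hall : ∀ x ∈ J \ {e}, x ∉ M.closure (I \ {e}) →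
            Y ⊆ M.closure (insert x (I \ {e})) := by
          intro x hx hxI
          by_contra hn
          exact hcon (add_old x hx hxI (fun _ => hn))
        obtain ⟨y, hyY, hyI⟩ := Set.not_subset.1 (hI' heI)
        have hIy : M.Indep (insert y (I \ {e})) :=
          hI.insert_indep_iff.2 (Or.inl ⟨hY hyY, hyI⟩)
        have hyn : y ∉ I \ {e} := fun h => hyI (M.subset_closure _ hI.subset_ground h)
        have hcy : (insert y (I \ {e})).ncard = I.ncard := by
          rw [Set.ncard_insert_of_notMem hyn hfI, hcI]
        have hsub : J \ {e} ⊆ M.closure (insert y (I \ {e})) := by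
          intro x hx
          by_cases hxI : x ∈ M.closure (I \ {e})
          · exact M.closure_subset_closure (Set.subset_insert _ _) hxI
          · exact (M.closure_exchange ⟨hall x hx hxI hyY, hyI⟩).1
        have hb := bound hIy hJ hsub
        by_cases heJ : e ∈ J
        · have hcJ : (J \ {e}).ncard + 1 = J.ncard :=
            Set.ncard_sdiff_singleton_add_one heJ ((hfJ.insert e).subset (by simp))
          have hk := key hIy hJ hsub (by omega)
          have hnot : ¬ J \ {e} ⊆ M.closure (I \ {e}) := fun h => by
            have := bound hI hJ h
            omega
          obtain ⟨x, hx, hxI⟩ := Set.not_subset.1 hnot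
          have hYx := hall x hx hxI
          have hxy : M.closure (insert y (I \ {e})) = M.closure (insert x (I \ {e})) :=
            M.closure_insert_congr ⟨hYx hyY, hyI⟩
          exact hJ' heJ (hYx.trans (hxy ▸ hk))
        · rw [Set.sdiff_singleton_eq_self heJ] at hb
          omega
      · have hI0 : I \ {e} = I := Set.sdiff_singleton_eq_self heI
        by_cases hsub : J \ {e} ⊆ M.closure (I \ {e})
        · have hb := bound hI hJ hsub
          rw [hI0] at hb
          by_cases heJ : e ∈ J
          · have hcJ : (J \ {e}).ncard + 1 = J.ncard :=
              Set.ncard_sdiff_singleton_add_one heJ ((hfJ.insert e).subset (by simp))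
            refine ⟨e, heJ, heI, by simpa using hI, fun _ h => hJ' heJ ?_⟩
            rw [Set.insert_sdiff_self_of_notMem heI, ← hI0] at h
            exact h.trans (key hI hJ hsub (by rw [hI0]; omega))
          · rw [Set.sdiff_singleton_eq_self heJ] at hb
            omega
        · obtain ⟨x, hx, hxI⟩ := Set.not_subset.1 hsub
          exact add_old x hx hxI (fun h => absurd h heI))
    (by
      rintro I ⟨hI, -⟩ x hx
      by_cases h : x = e
      · exact Or.inl h
      · exact Or.inr (hI.subset_ground ⟨hx, h⟩))).matroid

namespace Matroid

variable {α : Type u} {M : Matroid α} [M.Finite] {Y : Set α} {e : α}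

@[simp] theorem principalExtension_ground (hY : Y ⊆ M.E) (he : e ∉ M.E) :
    (M.principalExtension Y e hY he).E = insert e M.E := rfl

theorem principalExtension_indep_iff (hY : Y ⊆ M.E) (he : e ∉ M.E) {I : Set α} :
    (M.principalExtension Y e hY he).Indep I ↔
      M.Indep (I \ {e}) ∧ (e ∈ I → ¬ Y ⊆ M.closure (I \ {e})) := Iff.rfl

/-- On subsets of `E(M)` the rank function of `M +_Y e` is that of `M`. -/
theorem eRk_principalExtension (hY : Y ⊆ M.E) (he : e ∉ M.E) {X : Set α} (hX : X ⊆ M.E) :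
    (M.principalExtension Y e hY he).eRk X = M.eRk X := by
  have heX : e ∉ X := fun h => he (hX h)
  obtain ⟨I, hI⟩ := M.exists_isBasis X hX
  have heI : e ∉ I := fun h => heX (hI.subset h)
  have h : (M.principalExtension Y e hY he).IsBasis I X := by
    rw [isBasis_iff (hX.trans (Set.subset_insert _ _))]
    refine ⟨?_, hI.subset, fun J hJ hIJ hJX => ?_⟩
    · rw [principalExtension_indep_iff, Set.sdiff_singleton_eq_self heI]
      exact ⟨hI.indep, fun h => absurd h heI⟩
    · rw [principalExtension_indep_iff,
        Set.sdiff_singleton_eq_self (fun h => heX (hJX h))] at hJ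
      exact hI.eq_of_subset_indep hJ.1 hIJ hJX
  rw [← hI.encard_eq_eRk, h.encard_eq_eRk]

/-- The rank in `M +_Y e` of a set containing `e`. -/
theorem eRk_principalExtension_insert (hY : Y ⊆ M.E) (he : e ∉ M.E) {X : Set α} (hX : X ⊆ M.E) :
    (M.principalExtension Y e hY he).eRk (insert e X) =
      min (M.eRk X + 1) (M.eRk (X ∪ Y)) := by
  have heX : e ∉ X := fun h => he (hX h)
  obtain ⟨I, hI⟩ := M.exists_isBasis X hX
  have heI : e ∉ I := fun h => heX (hI.subset h)
  have hIe : insert e I \ {e} = I := Set.insert_sdiff_self_of_notMem heI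
  have hgr : insert e X ⊆ (M.principalExtension Y e hY he).E := Set.insert_subset_insert hX
  by_cases hc : Y ⊆ M.closure X
  · have hr : M.eRk (X ∪ Y) = M.eRk X := by
      apply le_antisymm _ (M.eRk_mono Set.subset_union_left)
      rw [← M.eRk_closure_eq X]
      exact M.eRk_mono (Set.union_subset (M.subset_closure X hX) hc)
    rw [hr, min_eq_right le_self_add]
    have h : (M.principalExtension Y e hY he).IsBasis I (insert e X) := by
      rw [isBasis_iff hgr]
      refine ⟨?_, hI.subset.trans (Set.subset_insert _ _), fun J hJ hIJ hJX => ?_⟩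
      · rw [principalExtension_indep_iff, Set.sdiff_singleton_eq_self heI]
        exact ⟨hI.indep, fun h => absurd h heI⟩
      · rw [principalExtension_indep_iff] at hJ
        have hIJe : I = J \ {e} := by
          refine hI.eq_of_subset_indep hJ.1 ?_ ?_
          · exact Set.subset_sdiff_singleton hIJ heI
          · rintro x ⟨hx, hxe⟩
            exact (hJX hx).resolve_left hxe
        have heJ : e ∉ J := fun h => hJ.2 h (by rw [← hIJe, hI.closure_eq_closure]; exact hc)
        rwa [Set.sdiff_singleton_eq_self heJ] at hIJe
    rw [← h.encard_eq_eRk, hI.encard_eq_eRk]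
  · have hr : M.eRk X + 1 ≤ M.eRk (X ∪ Y) := by
      obtain ⟨y, hyY, hy⟩ := Set.not_subset.1 hc
      have hyI : y ∉ M.closure I := by rwa [hI.closure_eq_closure]
      have hyn : y ∉ I := fun h => hyI (M.subset_closure _ hI.indep.subset_ground h)
      rw [← hI.encard_eq_eRk, ← Set.encard_insert_of_notMem hyn]
      refine Indep.encard_le_eRk_of_subset
        (hI.indep.insert_indep_iff.2 (Or.inl ⟨hY hyY, hyI⟩)) ?_
      exact Set.insert_subset (Or.inr hyY) (hI.subset.trans Set.subset_union_left)
    rw [min_eq_left hr]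
    have h : (M.principalExtension Y e hY he).IsBasis (insert e I) (insert e X) := by
      rw [isBasis_iff hgr]
      refine ⟨?_, Set.insert_subset_insert hI.subset, fun J hJ hIJ hJX => ?_⟩
      · rw [principalExtension_indep_iff, hIe, hI.closure_eq_closure]
        exact ⟨hI.indep, fun _ => hc⟩
      · rw [principalExtension_indep_iff] at hJ
        have heJ : e ∈ J := hIJ (Set.mem_insert _ _)
        have hIJe : I = J \ {e} := by
          refine hI.eq_of_subset_indep hJ.1 ?_ ?_
          · exact Set.subset_sdiff_singleton ((Set.subset_insert _ _).trans hIJ) heI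
          · rintro x ⟨hx, hxe⟩
            exact (hJX hx).resolve_left hxe
        rw [hIJe, Set.insert_sdiff_singleton, Set.insert_eq_of_mem heJ]
    rw [← h.encard_eq_eRk, Set.encard_insert_of_notMem heI, hI.encard_eq_eRk]

/-- The truncation of `M`, that is, `(M +_{E(M)} e) / e`; here `e` is an auxiliary element
outside `E(M)`. -/
def truncation {α : Type u} (M : Matroid α) [M.Finite] (e : α) (he : e ∉ M.E) : Matroid α :=
  (M.principalExtension M.E e subset_rfl he) ／ {e}

/-- Two matroids, possibly on different types, are isomorphic if some bijection between their
ground sets preserves independence in both directions. -/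
def IsIsomorphic {α : Type u} {β : Type v} (M : Matroid α) (N : Matroid β) : Prop :=
  ∃ φ : M.E ≃ N.E, ∀ I : Set M.E,
    M.Indep (Subtype.val '' I) ↔ N.Indep (Subtype.val '' (φ '' I))

end Matroid

/-- `l` is the vertex sequence of a directed path of `Γ` from `x` to `y`.  A single vertex is a
path from that vertex to itself. -/
def Digraph.IsDirectedPath {V : Type u} (Γ : Digraph V) (x y : V) (l : List V) : Prop :=
  l.head? = some x ∧ l.getLast? = some y ∧ l.IsChain Γ.Adj ∧ l.Nodup

/-- `X` is linked to `Z` in `Γ`: there are pairwise vertex-disjoint directed paths which pair the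
elements of `X` (initial vertices) bijectively with the elements of `Z` (terminal vertices). -/
def Digraph.IsLinkedTo {V : Type u} (Γ : Digraph V) (X Z : Set V) : Prop :=
  ∃ (σ : X ≃ Z) (P : X → List V),
    (∀ x : X, Γ.IsDirectedPath (x : V) (σ x : V) (P x)) ∧
    Pairwise fun x x' : X => (P x).Disjoint (P x')

/-- `N` is the matroid `Γ(M)` that the directed graph `Γ` with vertex set `V` induces from `M`:
its ground set is `V`, and a set of vertices is independent if and only if it is linked to an
independent set of `M`. -/
def Digraph.IsInducedMatroid {V : Type u} (Γ : Digraph V) (M N : Matroid V) : Prop :=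
  N.E = Set.univ ∧ ∀ X : Set V, N.Indep X ↔ ∃ I, M.Indep I ∧ Γ.IsLinkedTo X I

/-- A class of (finite) matroids: a collection of matroids closed under isomorphism. -/
structure MatroidClass where
  Mem : ∀ {α : Type u}, Matroid α → Prop
  finite_of_mem : ∀ {α : Type u} {M : Matroid α}, Mem M → M.Finite
  mem_of_isIsomorphic : ∀ {α β : Type u} {M : Matroid α} {N : Matroid β},
    Mem M → M.IsIsomorphic N → Mem N

namespace MatroidClass

def ClosedUnderMinors (C : MatroidClass.{u}) : Prop :=
  ∀ {α : Type u} (M N : Matroid α), C.Mem M → N.IsMinor M → C.Mem N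

def ClosedUnderDuals (C : MatroidClass.{u}) : Prop :=
  ∀ {α : Type u} (M : Matroid α), C.Mem M → C.Mem M.dual

def ClosedUnderDirectSums (C : MatroidClass.{u}) : Prop :=
  ∀ {α : Type u} (M N : Matroid α) (h : Disjoint M.E N.E),
    C.Mem M → C.Mem N → C.Mem (M.disjointSum N h)

def ClosedUnderTruncations (C : MatroidClass.{u}) : Prop :=
  ∀ {α : Type u} (M : Matroid α) [M.Finite] (e : α) (he : e ∉ M.E),
    C.Mem M → C.Mem (M.truncation e he)

def ClosedUnderPrincipalExtension (C : MatroidClass.{u}) : Prop :=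
  ∀ {α : Type u} (M : Matroid α) [M.Finite] (Y : Set α) (e : α) (hY : Y ⊆ M.E) (he : e ∉ M.E),
    C.Mem M → C.Mem (M.principalExtension Y e hY he)

/-- For every finite directed graph `Γ` and every matroid `M` in the class with
`E(M) ⊆ V(Γ)`, the induced matroid `Γ(M)` exists and is in the class. -/
def ClosedUnderDirectedInduction (C : MatroidClass.{u}) : Prop :=
  ∀ {V : Type u} [Finite V] (Γ : Digraph V) (M : Matroid V),
    C.Mem M → ∃ N : Matroid V, Γ.IsInducedMatroid M N ∧ C.Mem N

/-- A class of matroids is complete if it is closed under minors, duals, direct sums, truncations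
and induction by directed graphs. -/
def IsComplete (C : MatroidClass.{u}) : Prop :=
  C.ClosedUnderMinors ∧ C.ClosedUnderDuals ∧ C.ClosedUnderDirectSums ∧
    C.ClosedUnderTruncations ∧ C.ClosedUnderDirectedInduction

end MatroidClass

/-! The theorem comes from a dictionary between linkings and matchings, after which directed
induction is a chain of principal extensions followed by a contraction.

A linking of `X` into `S` is recorded by a successor map `g`: follow the paths where there are any,
and fix every other vertex. Off `S` this map is injective, misses `X`, and moves each vertex along
an arc or not at all. Conversely, the orbits of such a map from `X`, stopped on first meeting `S`,
are disjoint paths. Hence `X` is independent in `Γ(M)` iff such a `g` exists for some independent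
`S` (`exists_indep_isLinkedTo_iff`).

Such a pair `(S, g)` is a matching. Put a copy of `M` beside a free matroid on a copy of `V`, and
for each vertex `v` add an element `t v` freely to the free copies of `v` and its out-neighbours,
together with the `M`-copy of `v` if there is one. Matching `t v` to the `M`-copy means `v ∈ S`;
matching it to the free copy of `w` means `g v = w`. Contracting all `t v` forces all of them to be
matched, to places disjoint from `X`, so restricting to the free copy leaves `Γ(M)`. Free matroids
are available as duals of loopy ones.

In the other direction, `M +_Y e` is induced by the graph whose arcs run from `e` to the elements of
`Y`. -/

open Set in
theorem Matroid.isIsomorphic_of_image {α : Type u} {β : Type v} {M : Matroid α} {N : Matroid β}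
    {f : α → β} (hf : f.Injective) (hE : N.E = f '' M.E)
    (h : ∀ I ⊆ M.E, M.Indep I ↔ N.Indep (f '' I)) : M.IsIsomorphic N := by
  refine ⟨(Equiv.Set.image f M.E hf).trans (Equiv.setCongr hE.symm), fun I => ?_⟩
  rw [h _ (Subtype.coe_image_subset _ _)]
  have : f '' (Subtype.val '' I) = Subtype.val ''
      (((Equiv.Set.image f M.E hf).trans (Equiv.setCongr hE.symm)) '' I) := by
    simp only [image_image]
    rfl
  rw [this]

theorem Matroid.IsIsomorphic.symm {α : Type u} {β : Type v} {M : Matroid α} {N : Matroid β}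
    (h : M.IsIsomorphic N) : N.IsIsomorphic M := by
  obtain ⟨φ, hφ⟩ := h
  refine ⟨φ.symm, fun I => ?_⟩
  rw [hφ, Equiv.image_symm_image]

/-! ### Linkings as successor maps. -/

namespace Digraph

variable {V : Type u} {Γ : Digraph V} {X S : Set V} {g : V → V}

/-- Orbits of a map `g` that is injective off `S`, avoids `X` off `S`, and start in `X`
do not meet before they reach `S`. -/
theorem iterate_eq_iterate (hinj : Set.InjOn g Sᶜ) (hX : ∀ v ∉ S, g v ∉ X) :
    ∀ {i j : ℕ} {x y : V}, x ∈ X → y ∈ X → (∀ k < i, g^[k] x ∉ S) → (∀ k < j, g^[k] y ∉ S) →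
      g^[i] x = g^[j] y → i = j ∧ x = y := by
  intro i
  induction i with
  | zero =>
    intro j x y hx hy _ hj h
    cases j with
    | zero => exact ⟨rfl, h⟩
    | succ j =>
      -- A point of `X` would be the image under `g` of a point off `S`.
      rw [Function.iterate_succ_apply'] at h
      exact absurd (h ▸ hx) (hX _ (hj j j.lt_succ_self))
  | succ i ih =>
    intro j x y hx hy hi hj h
    rw [Function.iterate_succ_apply'] at h
    cases j with
    | zero => exact absurd (h.symm ▸ hy) (hX _ (hi i i.lt_succ_self))
    | succ j =>
      rw [Function.iterate_succ_apply'] at h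
      obtain ⟨h1, h2⟩ := ih hx hy (fun k hk => hi k (by omega)) (fun k hk => hj k (by omega))
        (hinj (hi i i.lt_succ_self) (hj j j.lt_succ_self) h)
      exact ⟨by omega, h2⟩

/-- The paths are the orbits of `X` cut at the first visit to `S`. Only a subset of `S` need be
reached, which suffices because independence passes to subsets. -/
theorem exists_isLinkedTo_of_iterate [Finite V] (hinj : Set.InjOn g Sᶜ) (hX : ∀ v ∉ S, g v ∉ X)
    (hg : ∀ v ∉ S, g v = v ∨ Γ.Adj v (g v)) : ∃ I ⊆ S, Γ.IsLinkedTo X I := by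
  classical
  have hex : ∀ x : X, ∃ n, g^[n] (x : V) ∈ S := by
    intro x
    by_contra! hcon
    -- An orbit that never met `S` would repeat a vertex, against `iterate_eq_iterate`.
    obtain ⟨i, j, hij, h⟩ := Finite.exists_ne_map_eq_of_infinite (fun n : ℕ => g^[n] (x : V))
    exact hij (iterate_eq_iterate hinj hX x.2 x.2 (fun k _ => hcon k) (fun k _ => hcon k) h).1
  let n : X → ℕ := fun x => Nat.find (hex x)
  have hn : ∀ x : X, g^[n x] (x : V) ∈ S := fun x => Nat.find_spec (hex x)
  have hlt : ∀ x : X, ∀ k < n x, g^[k] (x : V) ∉ S := fun x k hk => Nat.find_min (hex x) hk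
  have key : ∀ (x y : X) (i j : ℕ), i ≤ n x → j ≤ n y → g^[i] (x : V) = g^[j] (y : V) →
      i = j ∧ x = y := by
    intro x y i j hi hj h
    obtain ⟨h1, h2⟩ := iterate_eq_iterate hinj hX x.2 y.2 (fun k hk => hlt x k (by omega))
      (fun k hk => hlt y k (by omega)) h
    exact ⟨h1, Subtype.ext h2⟩
  have hσ : Function.Injective fun x : X => g^[n x] (x : V) :=
    fun x y h => (key x y _ _ le_rfl le_rfl h).2
  refine ⟨Set.range fun x : X => g^[n x] (x : V), Set.range_subset_iff.2 hn,
    Equiv.ofInjective _ hσ, fun x => (List.range (n x + 1)).map fun k => g^[k] (x : V), ?_, ?_⟩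
  · intro x
    refine ⟨by simp, by simp only [List.getLast?_map, List.getLast?_range]; simp, ?_, ?_⟩
    · rw [List.isChain_iff_getElem]
      intro i hi
      simp only [List.length_map, List.length_range] at hi
      simp only [List.getElem_map, List.getElem_range, Function.iterate_succ_apply']
      -- A fixed point before `S` would make two consecutive iterates equal.
      refine (hg _ (hlt x i (by omega))).resolve_left fun h => ?_
      rw [← Function.iterate_succ_apply' g] at h
      have := (key x x (i + 1) i (by omega) (by omega) h).1
      omega
    · refine List.nodup_range.map_on fun i hi j hj h => ?_
      rw [List.mem_range] at hi hj
      exact (key x x i j (by omega) (by omega) h).1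
  · intro x y hxy a ha hb
    rw [List.mem_map] at ha hb
    obtain ⟨i, hi, rfl⟩ := ha
    obtain ⟨j, hj, h⟩ := hb
    rw [List.mem_range] at hi hj
    exact hxy (key x y i j (by omega) (by omega) h.symm).2

/-- Take the next vertex on a path, and the identity where there is none. A path vertex off `S`
always has a successor, since its path ends in `S`. -/
theorem IsLinkedTo.exists_map (h : Γ.IsLinkedTo X S) :
    ∃ g : V → V, Set.InjOn g Sᶜ ∧ (∀ v ∉ S, g v ∉ X) ∧ ∀ v ∉ S, g v = v ∨ Γ.Adj v (g v) := by
  classical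
  obtain ⟨σ, P, hP, hdisj⟩ := h
  have unique : ∀ {x y : X} {i j : ℕ} {a : V}, (P x)[i]? = some a → (P y)[j]? = some a →
      x = y ∧ i = j := by
    intro x y i j a hi hj
    have hxy : x = y := by
      by_contra hne
      exact hdisj hne (List.mem_of_getElem? hi) (List.mem_of_getElem? hj)
    subst hxy
    obtain ⟨hlt, -⟩ := List.getElem?_eq_some_iff.1 hi
    exact ⟨rfl, (List.getElem?_inj hlt (hP x).2.2.2).1 (hi.trans hj.symm)⟩
  have hhead : ∀ x : X, (P x)[0]? = some (x : V) := fun x => by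
    rw [← List.head?_eq_getElem?]; exact (hP x).1
  let R : V → V → Prop := fun v w => ∃ x i, (P x)[i]? = some v ∧ (P x)[i + 1]? = some w
  have hnext : ∀ {x : X} {i : ℕ} {v : V}, (P x)[i]? = some v → v ∉ S → ∃ w, R v w := by
    intro x i v hv hvS
    obtain ⟨hi, hiv⟩ := List.getElem?_eq_some_iff.1 hv
    by_cases hlast : i + 1 < (P x).length
    · exact ⟨_, x, i, hv, List.getElem?_eq_getElem hlast⟩
    · have hl := (hP x).2.1
      rw [List.getLast?_eq_getElem?, show (P x).length - 1 = i by omega, hv] at hl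
      exact absurd ((Option.some.inj hl) ▸ (σ x).2) hvS
  let g : V → V := fun v => if h : ∃ w, R v w then h.choose else v
  have hgR : ∀ v, (∃ w, R v w) → R v (g v) := fun v h => by
    simp only [g, dif_pos h]; exact h.choose_spec
  have hgn : ∀ v, (¬ ∃ w, R v w) → g v = v := fun v h => by simp only [g, dif_neg h]
  refine ⟨g, ?_, ?_, ?_⟩
  -- A fixed vertex `w ∉ S` without successor lies on no path, so it is not the successor of another
  -- vertex.
  · have mixed : ∀ v ∉ S, ∀ w ∉ S, (∃ a, R v a) → (¬ ∃ a, R w a) → g v ≠ g w := by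
      intro v _ w hw hv hwn heq
      obtain ⟨x, i, -, h2⟩ := hgR v hv
      rw [heq, hgn w hwn] at h2
      exact hwn (hnext h2 hw)
    intro v hv w hw heq
    by_cases h1 : ∃ a, R v a <;> by_cases h2 : ∃ a, R w a
    · obtain ⟨x, i, hi, hi'⟩ := hgR v h1
      obtain ⟨y, j, hj, hj'⟩ := hgR w h2
      rw [heq] at hi'
      obtain ⟨rfl, hij⟩ := unique hi' hj'
      obtain rfl : i = j := by omega
      exact Option.some.inj (hi.symm.trans hj)
    · exact absurd heq (mixed v hv w hw h1 h2)
    · exact absurd heq.symm (mixed w hw v hv h2 h1)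
    · rwa [hgn v h1, hgn w h2] at heq
  · intro v hv hvX
    by_cases h : ∃ a, R v a
    · obtain ⟨x, i, -, hi⟩ := hgR v h
      have := (unique hi (hhead ⟨_, hvX⟩)).2
      omega
    · rw [hgn v h] at hvX
      exact h (hnext (hhead ⟨v, hvX⟩) hv)
  · intro v _
    by_cases h : ∃ a, R v a
    · obtain ⟨x, i, hi, hi'⟩ := hgR v h
      obtain ⟨_, hv⟩ := List.getElem?_eq_some_iff.1 hi
      obtain ⟨hlt, hgv⟩ := List.getElem?_eq_some_iff.1 hi'
      have := List.isChain_iff_getElem.1 (hP x).2.2.1 i hlt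
      rw [hv, hgv] at this
      exact Or.inr this
    · exact Or.inl (hgn v h)

/-- Linkings of `X` into `S` described by successor maps. -/
theorem exists_indep_isLinkedTo_iff [Finite V] (M : Matroid V) :
    (∃ I, M.Indep I ∧ Γ.IsLinkedTo X I) ↔
      ∃ (S : Set V) (g : V → V), M.Indep S ∧ Set.InjOn g Sᶜ ∧ (∀ v ∉ S, g v ∉ X) ∧
        ∀ v ∉ S, g v = v ∨ Γ.Adj v (g v) := by
  constructor
  · rintro ⟨I, hI, h⟩
    obtain ⟨g, hg⟩ := h.exists_map
    exact ⟨I, g, hI, hg⟩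
  · rintro ⟨S, g, hS, hinj, hX, hg⟩
    obtain ⟨I, hIS, hI⟩ := exists_isLinkedTo_of_iterate hinj hX hg
    exact ⟨I, hS.subset hIS, hI⟩

end Digraph

/-! ### Independence in a principal extension. -/

namespace Matroid

variable {α : Type u} {M : Matroid α} {Y I : Set α} {e : α}

theorem Indep.not_subset_closure_iff {J : Set α} (hJ : M.Indep J) (hY : Y ⊆ M.E) :
    ¬ Y ⊆ M.closure J ↔ ∃ y ∈ Y, y ∉ J ∧ M.Indep (insert y J) := by
  rw [Set.not_subset]
  refine exists_congr fun y => and_congr_right fun hy => ?_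
  rw [hJ.notMem_closure_iff (hY hy)]
  tauto

/-- The new element can be traded for some `y ∈ Y`; this exchange form is what turns into matchings
and arcs. -/
theorem principalExtension_indep_iff_of_mem [M.Finite] (hY : Y ⊆ M.E) (he : e ∉ M.E)
    (heI : e ∈ I) : (M.principalExtension Y e hY he).Indep I ↔
      ∃ y ∈ Y, y ∉ I \ {e} ∧ M.Indep (insert y (I \ {e})) := by
  rw [principalExtension_indep_iff]
  constructor
  · rintro ⟨h1, h2⟩
    exact (h1.not_subset_closure_iff hY).1 (h2 heI)
  · rintro ⟨y, hy, hyI, h⟩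
    have h1 := h.subset (Set.subset_insert _ _)
    exact ⟨h1, fun _ => (h1.not_subset_closure_iff hY).2 ⟨y, hy, hyI, h⟩⟩

theorem principalExtension_indep_iff_of_notMem [M.Finite] (hY : Y ⊆ M.E) (he : e ∉ M.E)
    (heI : e ∉ I) : (M.principalExtension Y e hY he).Indep I ↔ M.Indep I := by
  simp [principalExtension_indep_iff, heI]

end Matroid

open scoped Matroid

/-! ### Iterated principal extensions. -/

namespace MatroidClass

variable {C : MatroidClass.{u}}

/-- Adding the elements `s` of `S` in turn, each freely to a set `Y s` of old elements, yields the
matroid whose independent sets are those that can be matched onto independent sets of `M`. -/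
theorem ClosedUnderPrincipalExtension.exists_transversal_extension
    (hC : C.ClosedUnderPrincipalExtension) {α : Type u} {M : Matroid α} (hM : C.Mem M)
    (Y : α → Set α) (S : Finset α) (hS : Disjoint M.E S) (hY : ∀ s ∈ S, Y s ⊆ M.E) :
    ∃ N : Matroid α, C.Mem N ∧ N.E = M.E ∪ S ∧ ∀ I ⊆ N.E, N.Indep I ↔
      ∃ f : α → α, Set.InjOn f I ∧ (∀ x ∈ I, x ∈ M.E → f x = x) ∧
        (∀ x ∈ I, x ∈ S → f x ∈ Y x) ∧ M.Indep (f '' I) := by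
  classical
  induction S using Finset.induction_on with
  | empty =>
    refine ⟨M, hM, by simp, fun I hI => ⟨fun h => ⟨id, by simpa using h⟩, ?_⟩⟩
    rintro ⟨f, -, hf, -, h⟩
    rwa [Set.image_congr (fun x hx => hf x hx (hI hx)), Set.image_id'] at h
  | insert e S heS ih =>
    rw [Finset.coe_insert, Set.disjoint_insert_right] at hS
    obtain ⟨N, hN, hNE, hNI⟩ := ih hS.2 fun s hs => hY s (Finset.mem_insert_of_mem hs)
    have := C.finite_of_mem hN
    have heM := hS.1
    have heN : e ∉ N.E := by simp [hNE, heM, heS]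
    have hYM : Y e ⊆ M.E := hY e (Finset.mem_insert_self _ _)
    have hYe : Y e ⊆ N.E := by
      rw [hNE]; exact hYM.trans Set.subset_union_left
    refine ⟨N.principalExtension (Y e) e hYe heN, hC _ _ _ _ _ hN, ?_, fun I hI => ?_⟩
    · simp [hNE, Set.union_insert]
    rw [Matroid.principalExtension_ground] at hI
    by_cases heI : e ∈ I
    · have hJE : I \ {e} ⊆ N.E := by
        rintro x ⟨hx, hxe⟩
        exact (hI hx).resolve_left hxe
      have heJ : e ∉ I \ {e} := fun h => h.2 rfl
      rw [Matroid.principalExtension_indep_iff_of_mem _ _ heI]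
      obtain ⟨J, hJ⟩ : ∃ J, J = I \ {e} := ⟨_, rfl⟩
      obtain rfl : I = insert e J := by simp [hJ, heI]
      rw [← hJ] at hJE heJ ⊢
      constructor
      · rintro ⟨y, hy, hyJ, h⟩
        have hyM := hYM hy
        obtain ⟨f, hinj, hfM, hfS, hfI⟩ := (hNI _ (Set.insert_subset (hYe hy) hJE)).1 h
        have hfy : f y = y := hfM y (Set.mem_insert _ _) hyM
        have hJf : Set.EqOn (Function.update f e y) f J := fun x hx =>
          Function.update_of_ne (fun h => heJ (by rwa [← h])) _ _
        -- The element `e` takes over from `y`, which `f` fixes, so the image is unchanged.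
        have himg : Function.update f e y '' insert e J = f '' insert y J := by
          rw [Set.image_insert_eq, Set.image_insert_eq, Function.update_self, hfy,
            hJf.image_eq]
        refine ⟨Function.update f e y, ?_, ?_, ?_, by rwa [himg]⟩
        · rw [Set.injOn_insert heJ, hJf.injOn_iff, hJf.image_eq, Function.update_self]
          rw [Set.injOn_insert hyJ, hfy] at hinj
          exact hinj
        · rintro x (rfl | hx) hxM
          · exact absurd hxM heM
          · rw [hJf hx]; exact hfM x (Or.inr hx) hxM
        · rintro x (rfl | hx) hxS
          · rwa [Function.update_self]
          · rw [hJf hx]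
            refine hfS x (Or.inr hx) ((Finset.mem_insert.1 hxS).resolve_left ?_)
            rintro rfl
            exact heJ hx
      · rintro ⟨f, hinj, hfM, hfS, hfI⟩
        have hy : f e ∈ Y e := hfS e (Set.mem_insert _ _) (Finset.mem_insert_self _ _)
        have hyM := hYM hy
        have hinj' := (Set.injOn_insert heJ).1 hinj
        -- Since `f` fixes old elements, `f e ∈ J` would give `f e` two preimages.
        have hyJ : f e ∉ J := fun h =>
          hinj'.2 ⟨f e, h, hfM _ (Or.inr h) hyM⟩
        have hJf : Set.EqOn (Function.update f (f e) (f e)) f J := fun x hx =>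
          Function.update_of_ne (fun h => hyJ (by rwa [← h])) _ _
        refine ⟨f e, hy, hyJ, (hNI _ (Set.insert_subset (hYe hy) hJE)).2
          ⟨Function.update f (f e) (f e), ?_, ?_, ?_, ?_⟩⟩
        · rw [Set.injOn_insert hyJ, hJf.injOn_iff, hJf.image_eq, Function.update_self]
          exact hinj'
        · rintro x (rfl | hx) hxM
          · rw [Function.update_self]
          · rw [hJf hx]; exact hfM x (Or.inr hx) hxM
        · rintro x (rfl | hx) hxS
          · exact absurd hxS fun h => (Set.disjoint_left.1 hS.2 hyM) h
          · rw [hJf hx]; exact hfS x (Or.inr hx) (Finset.mem_insert_of_mem hxS)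
        · rwa [Set.image_insert_eq, Function.update_self, hJf.image_eq, ← Set.image_insert_eq]
    · rw [Matroid.principalExtension_indep_iff_of_notMem _ _ heI,
        hNI I fun x hx => (hI hx).resolve_left fun h => heI (by rwa [← h])]
      refine exists_congr fun f => and_congr_right fun _ => and_congr_right fun _ =>
        and_congr_left fun _ => forall₂_congr fun x hx => ?_
      have hxe : x ≠ e := fun h => heI (by rwa [← h])
      simp [hxe]

/-- An element added freely to `∅` is a loop, and the empty matroid is a minor of any member. Some
member `M` is needed, as a class may be empty. -/
theorem ClosedUnderPrincipalExtension.mem_loopyOn (hC : C.ClosedUnderPrincipalExtension)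
    (hm : C.ClosedUnderMinors) {α : Type u} {M : Matroid α} (hM : C.Mem M) {S : Set α}
    (hS : S.Finite) : C.Mem (Matroid.loopyOn S) := by
  have h0 : C.Mem (Matroid.emptyOn α) := by
    have := hm M _ hM (M.contract_delete_isMinor ∅ M.E)
    rwa [Matroid.contract_empty, ← Matroid.restrict_compl, Set.sdiff_self,
      Matroid.restrict_empty] at this
  obtain ⟨N, hN, hNE, hNI⟩ := hC.exists_transversal_extension h0 (fun _ => ∅) hS.toFinset
    (by simp) (by simp)
  have hNE' : N.E = S := by simpa using hNE
  convert hN using 1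
  refine (Matroid.ext_indep (by simp [hNE']) fun I hI => ?_)
  rw [hNI I (by simpa [hNE'] using hI), Matroid.loopyOn_indep_iff]
  constructor
  · rintro rfl
    exact ⟨id, by simp⟩
  · rintro ⟨f, -, -, -, h⟩
    simpa using h

/-! ### From directed induction to principal extensions. -/

theorem ClosedUnderDirectedInduction.closedUnderPrincipalExtension
    (hC : C.ClosedUnderDirectedInduction) : C.ClosedUnderPrincipalExtension := by
  classical
  intro α M _ Y e hY he hM
  have hfin : Finite ↥(insert e M.E) := (M.ground_finite.insert e).to_subtype
  -- An induced matroid lives on all of its vertex type, so that type must be exactly `E(M) ∪ {e}`.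
  let ι : ↥(insert e M.E) → α := Subtype.val
  have hι : ι.Injective := Subtype.val_injective
  let e₀ : ↥(insert e M.E) := ⟨e, Set.mem_insert _ _⟩
  have hind : ∀ I, (M.comap ι).Indep I ↔ M.Indep (ι '' I) := fun I => by
    simp [Matroid.comap_indep_iff, hι.injOn]
  have hM' : C.Mem (M.comap ι) := by
    refine C.mem_of_isIsomorphic hM (Matroid.IsIsomorphic.symm
      (Matroid.isIsomorphic_of_image hι ?_ fun I _ => hind I))
    rw [Matroid.comap_ground_eq, Set.image_preimage_eq_of_subset]
    exact fun a ha => ⟨⟨a, Or.inr ha⟩, rfl⟩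
  let Γ : Digraph ↥(insert e M.E) := ⟨fun a b => a = e₀ ∧ (b : α) ∈ Y⟩
  obtain ⟨N, ⟨hNE, hNI⟩, hN⟩ := hC Γ _ hM'
  refine C.mem_of_isIsomorphic hN (Matroid.isIsomorphic_of_image hι ?_ fun X _ => ?_)
  · rw [hNE, Set.image_univ, Matroid.principalExtension_ground, Subtype.range_coe]
  rw [hNI, Digraph.exists_indep_isLinkedTo_iff]
  -- Only `e₀` has outgoing arcs, so any other element of `X` off `S` would be fixed by `g`, which
  -- may not take values in `X` there.
  have hold : ∀ {S : Set ↥(insert e M.E)} {g : ↥(insert e M.E) → ↥(insert e M.E)},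
      (∀ v ∉ S, g v ∉ X) → (∀ v ∉ S, g v = v ∨ Γ.Adj v (g v)) → X \ {e₀} ⊆ S := by
    intro S g hX hg x hx
    by_contra hxS
    rcases hg x hxS with h | h
    · exact hX x hxS (by rw [h]; exact hx.1)
    · exact hx.2 h.1
  by_cases heX : e₀ ∈ X
  · have hιX : ι '' X \ {e} = ι '' (X \ {e₀}) := by
      rw [Set.image_sdiff hι, Set.image_singleton]
    have heX' : e ∈ ι '' X := ⟨e₀, heX, rfl⟩
    rw [Matroid.principalExtension_indep_iff_of_mem hY he heX', hιX]
    constructor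
    · rintro ⟨S, g, hS, hinj, hX, hg⟩
      rw [hind] at hS
      have heS : e₀ ∉ S := fun h => he (hS.subset_ground ⟨e₀, h, rfl⟩)
      have hadj : (g e₀ : α) ∈ Y :=
        ((hg e₀ heS).resolve_left fun h => hX e₀ heS (by rwa [h])).2
      have hne : g e₀ ≠ e₀ := fun h => hX e₀ heS (by rwa [h])
      -- Off `S`, the vertex `g e₀` would be fixed and so share its image with `e₀`.
      have hgS : g e₀ ∈ S := by
        by_contra hn
        rcases hg _ hn with h | h
        · exact hne (hinj hn heS h)
        · exact hne h.1
      refine ⟨_, hadj, ?_, hS.subset ?_⟩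
      · rintro ⟨a, ha, h⟩
        exact hX e₀ heS (hι h ▸ ha.1)
      · rw [Set.insert_subset_iff, Set.image_subset_image_iff hι]
        exact ⟨⟨_, hgS, rfl⟩, hold hX hg⟩
    · rintro ⟨y, hy, hyX, h⟩
      let y₀ : ↥(insert e M.E) := ⟨y, Or.inr (hY hy)⟩
      have hye : y₀ ≠ e₀ := fun h => he (by
        have : y = e := congrArg Subtype.val h
        exact this ▸ hY hy)
      have hyX' : y₀ ∉ X := fun h => hyX ⟨y₀, ⟨h, hye⟩, rfl⟩
      refine ⟨insert y₀ (X \ {e₀}), Function.update id e₀ y₀, ?_, ?_, ?_, ?_⟩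
      · rw [hind, Set.image_insert_eq]; exact h
      · intro v hv w hw hvw
        have hv' : v ≠ y₀ := fun h => hv (Or.inl h)
        have hw' : w ≠ y₀ := fun h => hw (Or.inl h)
        by_cases h1 : v = e₀ <;> by_cases h2 : w = e₀
        · rw [h1, h2]
        · simp [h1, Function.update_of_ne h2] at hvw
          exact absurd hvw.symm hw'
        · simp [h2, Function.update_of_ne h1] at hvw
          exact absurd hvw hv'
        · simpa [Function.update_of_ne h1, Function.update_of_ne h2] using hvw
      · intro v hv
        by_cases h1 : v = e₀
        · simpa [h1] using hyX'
        · rw [Function.update_of_ne h1]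
          exact fun h => hv (Or.inr ⟨h, h1⟩)
      · intro v hv
        by_cases h1 : v = e₀
        · exact Or.inr ⟨h1, by simpa [h1] using hy⟩
        · exact Or.inl (Function.update_of_ne h1 _ _)
  · have heX' : e ∉ ι '' X := by
      rintro ⟨a, ha, h⟩
      exact heX ((hι h : a = e₀) ▸ ha)
    rw [Matroid.principalExtension_indep_iff_of_notMem hY he heX', ← hind]
    constructor
    · rintro ⟨S, g, hS, -, hX, hg⟩
      have := hold hX hg
      rw [Set.sdiff_singleton_eq_self heX] at this
      exact hS.subset this
    · exact fun h => ⟨X, id, h, Set.injOn_id _, fun v hv => hv, fun v _ => Or.inl rfl⟩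

/-! ### From principal extensions to truncations and directed induction. -/

theorem ClosedUnderPrincipalExtension.closedUnderTruncations
    (hC : C.ClosedUnderPrincipalExtension) (hm : C.ClosedUnderMinors) :
    C.ClosedUnderTruncations :=
  fun M _ e he hM => hm _ _ (hC M M.E e subset_rfl he hM) ⟨{e}, ∅, by
    rw [Matroid.delete_empty]; rfl⟩

theorem ClosedUnderPrincipalExtension.closedUnderDirectedInduction
    (hC : C.ClosedUnderPrincipalExtension) (hm : C.ClosedUnderMinors)
    (hd : C.ClosedUnderDuals) (hs : C.ClosedUnderDirectSums) :
    C.ClosedUnderDirectedInduction := by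
  classical
  intro V _ Γ M hM
  -- three copies of `V`: the elements of `M`, the vertices of `Γ`, and the elements to contract
  let a : V → V ⊕ V ⊕ V := Sum.inl
  let x : V → V ⊕ V ⊕ V := Sum.inr ∘ Sum.inl
  let t : V → V ⊕ V ⊕ V := Sum.inr ∘ Sum.inr
  have ha : a.Injective := Sum.inl_injective
  have hx : x.Injective := Sum.inr_injective.comp Sum.inl_injective
  have ht : t.Injective := Sum.inr_injective.comp Sum.inr_injective
  let M₁ := M.map a ha.injOn
  have hM₁E : M₁.E = a '' M.E := rfl
  have hM₁I : ∀ I, M₁.Indep (a '' I) ↔ M.Indep I := by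
    intro I
    rw [Matroid.map_indep_iff]
    constructor
    · rintro ⟨J, hJ, h⟩
      rwa [ha.image_injective h]
    · exact fun h => ⟨I, h, rfl⟩
  have hM₁ : C.Mem M₁ := C.mem_of_isIsomorphic hM
    (Matroid.isIsomorphic_of_image ha hM₁E fun I _ => (hM₁I I).symm)
  have hF : C.Mem (Matroid.freeOn (Set.range x)) := by
    rw [← Matroid.loopyOn_dual_eq]
    exact hd _ (hC.mem_loopyOn hm hM₁ (Set.finite_range x))
  have hdisj : Disjoint M₁.E (Matroid.freeOn (Set.range x)).E := by
    rw [Set.disjoint_left, hM₁E, Matroid.freeOn_ground]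
    rintro _ ⟨v, -, rfl⟩ ⟨w, hw⟩
    cases hw
  have hM₂ := hs _ _ hdisj hM₁ hF
  let M₂ := M₁.disjointSum (Matroid.freeOn (Set.range x)) hdisj
  have hM₂E : M₂.E = a '' M.E ∪ Set.range x := by simp [M₂, hM₁E]
  have hM₂I : ∀ I, M₂.Indep I ↔ M₁.Indep (I ∩ a '' M.E) ∧ I ⊆ a '' M.E ∪ Set.range x := by
    intro I
    simp [M₂, Matroid.disjointSum_indep_iff, hM₁E]
  -- The choice `w = v` lets `g` fix `v`; the `a`-copy, offered only for `v ∈ E(M)`, lets `v` lie in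
  -- `S`.
  let Y : V ⊕ V ⊕ V → Set (V ⊕ V ⊕ V) := Sum.elim (fun _ => ∅) (Sum.elim (fun _ => ∅)
    fun v => x '' {w | w = v ∨ Γ.Adj v w} ∪ a '' {w | w = v ∧ v ∈ M.E})
  obtain ⟨N, hN, hNE, hNI⟩ := hC.exists_transversal_extension hM₂ Y
    (Set.finite_range t).toFinset (by
      change Disjoint M₂.E _
      rw [Set.disjoint_left, hM₂E, Set.Finite.coe_toFinset]
      rintro _ (⟨v, -, rfl⟩ | ⟨v, rfl⟩) ⟨w, hw⟩ <;> cases hw) (by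
      change ∀ s ∈ _, Y s ⊆ M₂.E
      intro s hs
      rw [Set.Finite.mem_toFinset] at hs
      obtain ⟨v, rfl⟩ := hs
      rw [hM₂E]
      rintro _ (⟨w, -, rfl⟩ | ⟨w, ⟨rfl, hw⟩, rfl⟩)
      · exact Or.inr ⟨w, rfl⟩
      · exact Or.inl ⟨w, hw, rfl⟩)
  change N.E = M₂.E ∪ _ at hNE
  change ∀ I ⊆ N.E, N.Indep I ↔ ∃ f : V ⊕ V ⊕ V → V ⊕ V ⊕ V, Set.InjOn f I ∧
    (∀ z ∈ I, z ∈ M₂.E → f z = z) ∧ (∀ z ∈ I, z ∈ (Set.finite_range t).toFinset → f z ∈ Y z) ∧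
    M₂.Indep (f '' I) at hNI
  rw [hM₂E, Set.Finite.coe_toFinset] at hNE
  simp only [Set.Finite.mem_toFinset] at hNI
  have key : ∀ X : Set V, N.Indep (x '' X ∪ Set.range t) ↔
      ∃ I, M.Indep I ∧ Γ.IsLinkedTo X I := by
    intro X
    rw [Digraph.exists_indep_isLinkedTo_iff, hNI]
    swap
    · rw [hNE]
      exact Set.union_subset_union_left _
        ((Set.image_subset_range _ _).trans Set.subset_union_right)
    constructor
    · rintro ⟨f, hinj, hfM, hfY, hfI⟩
      have hfx : ∀ v ∈ X, f (x v) = x v := fun v hv =>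
        hfM _ (Or.inl ⟨v, hv, rfl⟩) (hM₂E ▸ Or.inr ⟨v, rfl⟩)
      have hft : ∀ v, f (t v) ∈ Y (t v) := fun v => hfY _ (Or.inr ⟨v, rfl⟩) ⟨v, rfl⟩
      -- The default values do not matter: off `S = {v | f (t v) = a v}`, the value `f (t v)` lies
      -- in the `x`-copy.
      let g : V → V := fun v => Sum.elim (fun _ => v) (Sum.elim id fun _ => v) (f (t v))
      have hg : ∀ v, f (t v) ≠ a v → f (t v) = x (g v) ∧ (g v = v ∨ Γ.Adj v (g v)) := by
        intro v hv
        rcases hft v with ⟨w, hw, h⟩ | ⟨w, ⟨rfl, -⟩, h⟩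
        · have hgv : g v = w := by simp only [g, ← h]; rfl
          exact ⟨by rw [hgv, h], by rwa [hgv]⟩
        · exact absurd h.symm hv
      refine ⟨{v | f (t v) = a v}, g, ?_, ?_, ?_, fun v hv => (hg v hv).2⟩
      · rw [← hM₁I]
        refine ((hM₂I _).1 hfI).1.subset ?_
        rintro _ ⟨v, hv, rfl⟩
        refine ⟨⟨t v, Or.inr ⟨v, rfl⟩, hv⟩, ?_⟩
        rcases hft v with ⟨w, -, h⟩ | ⟨w, ⟨rfl, hw⟩, -⟩
        · have := h.trans hv
          cases this
        · exact ⟨w, hw, rfl⟩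
      · intro v hv w hw h
        refine ht (hinj (Or.inr ⟨v, rfl⟩) (Or.inr ⟨w, rfl⟩) ?_)
        rw [(hg v hv).1, (hg w hw).1, h]
      -- The elements of `x '' X` are matched to themselves, so no `t v` can use them.
      · intro v hv hvX
        have h := hinj (Or.inr ⟨v, rfl⟩) (Or.inl ⟨_, hvX, rfl⟩)
          ((hg v hv).1.trans (hfx _ hvX).symm)
        cases h
    · rintro ⟨S, g, hS, hinj, hX, hg⟩
      let f : V ⊕ V ⊕ V → V ⊕ V ⊕ V :=
        Sum.elim a (Sum.elim x fun v => if v ∈ S then a v else x (g v))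
      have hf1 : ∀ v ∈ S, f (t v) = a v := fun v hv => if_pos hv
      have hf2 : ∀ v ∉ S, f (t v) = x (g v) := fun v hv => if_neg hv
      have hfx : ∀ v, f (x v) = x v := fun v => rfl
      have hax : ∀ v w, a v ≠ x w := fun v w h => by cases h
      have hxt : ∀ v ∈ X, ∀ w, f (x v) ≠ f (t w) := by
        intro v hv w h
        rw [hfx] at h
        by_cases hw : w ∈ S
        · rw [hf1 w hw] at h
          exact hax _ _ h.symm
        · rw [hf2 w hw] at h
          exact hX w hw (hx h ▸ hv)
      refine ⟨f, ?_, ?_, ?_, ?_⟩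
      · rintro _ (⟨v, hv, rfl⟩ | ⟨v, rfl⟩) _ (⟨w, hw, rfl⟩ | ⟨w, rfl⟩) h
        · exact h
        · exact absurd h (hxt v hv w)
        · exact absurd h.symm (hxt w hw v)
        · by_cases hv : v ∈ S <;> by_cases hw : w ∈ S
          · rw [hf1 v hv, hf1 w hw] at h
            rw [ha h]
          · rw [hf1 v hv, hf2 w hw] at h
            exact absurd h (hax _ _)
          · rw [hf2 v hv, hf1 w hw] at h
            exact absurd h.symm (hax _ _)
          · rw [hf2 v hv, hf2 w hw] at h
            rw [hinj hv hw (hx h)]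
      · rw [hM₂E]
        rintro _ - (⟨v, -, rfl⟩ | ⟨v, rfl⟩) <;> rfl
      · rintro _ - ⟨v, rfl⟩
        by_cases hv : v ∈ S
        · rw [hf1 v hv]
          exact Or.inr ⟨v, ⟨rfl, hS.subset_ground hv⟩, rfl⟩
        · rw [hf2 v hv]
          exact Or.inl ⟨_, hg v hv, rfl⟩
      · rw [hM₂I]
        constructor
        · refine ((hM₁I S).2 hS).subset ?_
          rintro _ ⟨⟨_, ⟨w, -, rfl⟩ | ⟨w, rfl⟩, rfl⟩, v, -, h⟩
          · exact absurd h (hax _ _)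
          · by_cases hw : w ∈ S
            · exact ⟨w, hw, (hf1 w hw).symm⟩
            · rw [hf2 w hw] at h
              exact absurd h (hax _ _)
        · rintro _ ⟨_, ⟨w, -, rfl⟩ | ⟨w, rfl⟩, rfl⟩
          · exact Or.inr ⟨w, rfl⟩
          · by_cases hw : w ∈ S
            · rw [hf1 w hw]
              exact Or.inl ⟨w, hS.subset_ground hw, rfl⟩
            · rw [hf2 w hw]
              exact Or.inr ⟨_, rfl⟩
  -- With `X = S = ∅` and `g = id`, each `t v` is matched to `x v`. Independence of the contracted
  -- set gives the simple description of the contraction.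
  have htI : N.Indep (Set.range t) := by
    have h : N.Indep (x '' ∅ ∪ Set.range t) := by
      rw [key, Digraph.exists_indep_isLinkedTo_iff]
      exact ⟨∅, id, M.empty_indep, Set.injOn_id _, by simp, fun v _ => Or.inl rfl⟩
    simpa using h
  have hxt : ∀ X, Disjoint (x '' X) (Set.range t) := fun X => by
    rw [Set.disjoint_left]
    rintro _ ⟨v, -, rfl⟩ ⟨w, hw⟩
    cases hw
  have hxN : Set.range x ⊆ (N ／ Set.range t).E := by
    rw [Matroid.contract_ground, hNE]
    rintro _ ⟨v, rfl⟩
    refine ⟨Or.inl (Or.inr ⟨v, rfl⟩), ?_⟩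
    rintro ⟨w, hw⟩
    cases hw
  have hPI : ∀ X, ((N ／ Set.range t).comap x).Indep X ↔ N.Indep (x '' X ∪ Set.range t) := by
    intro X
    rw [Matroid.comap_indep_iff, htI.contract_indep_iff]
    simp [hx.injOn, hxt X]
  have hPE : ((N ／ Set.range t).comap x).E = Set.univ := by
    rw [Matroid.comap_ground_eq, Set.preimage_eq_univ_iff]
    exact hxN
  refine ⟨(N ／ Set.range t).comap x, ⟨hPE, fun X => (hPI X).trans (key X)⟩, ?_⟩
  -- The induced matroid on `V` is isomorphic, through `x`, to this minor of `N`.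
  have hminor : ((N ／ Set.range t) ↾ Set.range x).IsMinor N := by
    rw [← Matroid.delete_compl hxN]
    exact N.contract_delete_isMinor _ _
  refine C.mem_of_isIsomorphic (hm _ _ hN hminor)
    (Matroid.IsIsomorphic.symm (Matroid.isIsomorphic_of_image hx ?_ fun X _ => ?_))
  · rw [hPE, Set.image_univ, Matroid.restrict_ground_eq]
  · rw [Matroid.comap_indep_iff, Matroid.restrict_indep_iff]
    simp [hx.injOn]

end MatroidClass

theorem mainTheorem5 (C : MatroidClass.{u}) :
    C.IsComplete ↔
      C.ClosedUnderMinors ∧ C.ClosedUnderDuals ∧ C.ClosedUnderDirectSums ∧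
        C.ClosedUnderPrincipalExtension := by
  constructor
  · rintro ⟨hm, hd, hs, -, hi⟩
    exact ⟨hm, hd, hs, hi.closedUnderPrincipalExtension⟩
  · rintro ⟨hm, hd, hs, hp⟩
    exact ⟨hm, hd, hs, hp.closedUnderTruncations hm, hp.closedUnderDirectedInduction hm hd hs⟩
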